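/- Theorem 5.5. Let $f$ be a (real- or complex-valued) real-analytic function at $0$. For $n\ge 0$ let $C_{f,n}(x)$ be the Appell polynomials defined by $f(t)e^{xt}=\sum_{n\ge 0}\frac{C_{f,n}(x)}{n!}t^n$ for $t$ near $0$. Put $p_f(t)=\frac{e^t-1}{t}f(t)$ (with $p_f(0)=f(0)$), write $p_f(t)=\sum_{n\ge0}\frac{P_{f,n}}{n!}t^n$ near $0$, and put $\underline f(t)=e^{-t}f(-t)$. Assume that the power series $\sum_{k\ge0}P_{f,k}s^k$ has a non-zero radius of convergence $\rho_f\in(0,+\infty]$, and set $n_f=\lfloor 1/\rho_f\rfloor+1$ (with $1/\infty=0$). For $s\in\mathbb{C}\setminus\mathbb{R}_{\le 0}$ with $|s|>1/\rho_f$ and $z\in\mathbb{C}$ let $$s^{(z,f)}=\sum_{k=0}^{\infty}\binom{z}{k}P_{f,k}\,s^{z-k},$$ where powers of $s$ are taken with the principal branch. Let $L(z,f)$ be the function that is given for $\operatorname{Re} z>1$ by the absolutely convergent series $\sum_{n=n_f}^{\infty}n^{(-z,f)}$ and is extended analytically to $\mathbb{C}\setminus\{1\}$ (this extension exists and is unique).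 Then, for every integer $n\ge 0$, $$L(-n,f)=-\frac{C_{f,n+1}(n_f)}{n+1}=(-1)^n\,\frac{C_{\underline f,n+1}(1-n_f)}{n+1}.$$ -/

import Mathlib

namespace LC

noncomputable section

/-- The `C`-polynomials `C_{f,n}(x)` associated to `f`, defined by their exponential generating
function `f(t) e^{xt} = ∑ C_{f,n}(x) tⁿ / n!` near `t = 0`: for `f` analytic at `0`, `C_{f,n}(x)`
is the `n`-th derivative at `0` of `t ↦ f(t) e^{xt}`. -/
def cPoly (f : ℝ → ℂ) (n : ℕ) (x : ℂ) : ℂ :=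
  iteratedDeriv n (fun t : ℝ => f t * Complex.exp (x * (t : ℂ))) 0

/-- The function `p_f(t) = (e^t - 1) / t * f(t)`, extended by its limit `f(0)` at `t = 0`. -/
def pFun (f : ℝ → ℂ) (t : ℝ) : ℂ :=
  if t = 0 then f 0 else (Complex.exp (t : ℂ) - 1) / (t : ℂ) * f t

/-- The `P`-polynomials associated to `f` are the `C`-polynomials associated to `p_f`. -/
def pPoly (f : ℝ → ℂ) (n : ℕ) (x : ℂ) : ℂ := cPoly (pFun f) n x

/-- The `P`-numbers `P_{f,n} = P_{f,n}(0)`. -/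
def pNum (f : ℝ → ℂ) (n : ℕ) : ℂ := pPoly f n 0

/-- The function `f̲(t) = e^{-t} f(-t)`. -/
def under (f : ℝ → ℂ) (t : ℝ) : ℂ := Complex.exp (-(t : ℂ)) * f (-t)

/-- The radius of convergence `ρ_f ∈ [0, +∞]` of the power series `∑ P_{f,k} s^k`. -/
def rho (f : ℝ → ℂ) : ENNReal := (FormalMultilinearSeries.ofScalars ℂ (pNum f)).radius

/-- `n_f = ⌊1 / ρ_f⌋ + 1`, with `1 / ∞ = 0` (only meaningful for `ρ_f ≠ 0`). -/
def nMin (f : ℝ → ℂ) : ℕ := ⌊((rho f)⁻¹).toReal⌋₊ + 1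

/-- The generalized power `s^{(z,f)} = ∑_{k ≥ 0} binom(z,k) P_{f,k} s^{z-k}`, for `s` outside the
closed negative real axis with `|s| > 1 / ρ_f` (powers are taken with the principal branch). -/
def genPow (f : ℝ → ℂ) (s z : ℂ) : ℂ :=
  ∑' k : ℕ, Ring.choose z k * pNum f k * s ^ (z - (k : ℂ))

/-- `L` is (a version of) the `LC`-function associated to `f`: it is analytic on `ℂ ∖ {1}`, and for
`Re z > 1` it is the sum of the (absolutely convergent) series `∑_{n ≥ n_f} n^{(-z,f)}`. By the
identity theorem this determines `L` on `ℂ ∖ {1}`; the value `L 1` is left free. -/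
def IsLCFunction (f : ℝ → ℂ) (L : ℂ → ℂ) : Prop :=
  AnalyticOnNhd ℂ L {1}ᶜ ∧
    ∀ z : ℂ, 1 < z.re →
      HasSum (fun j : ℕ => genPow f ((nMin f + j : ℕ) : ℂ) (-z)) (L z)

end

end LC

/-! Put N = n_f. Expanding n^{(-z,f)} and exchanging sums gives, for Re z > 1, L(z) = ∑_k
binom(-z,k) P_k ζ(z+k, N). For k ≥ 1 the pole of ζ(z+k, N) at z = 1-k is cancelled by the factor
z+k-1 of binom(-z,k), so `lcTerm` pairs binom(-z,k)/(z+k-1) with the entire function (w-1)ζ(w, N) at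
w = z+k. For large k, ζ(z+k, N) decays like N^{-k}, while |P_k| ≤ C a^k with a < N; the series
therefore converges locally uniformly off z = 1 and continues L. At z = -n the first factor is
-binom(n+1,k)/(n+1), which vanishes for k > n+1, and the second is B_{n+1-k}(N). The finite sum left
is C_{f,n+1}(N), because f(t)e^{xt} = p_f(t) · te^{xt}/(e^t-1). The second formula is the reflection
t ↦ -t. -/

namespace LC

open Filter Topology

/-! ### Taylor series and Appell polynomials -/

/-- The Taylor series at `0` of a function on the real line. -/
noncomputable def taylorSeries (g : ℝ → ℂ) : PowerSeries ℂ :=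
  PowerSeries.mk fun n => ((n.factorial : ℂ))⁻¹ * iteratedDeriv n g 0

theorem taylorSeries_mul {g h : ℝ → ℂ} (hg : AnalyticAt ℝ g 0) (hh : AnalyticAt ℝ h 0) :
    taylorSeries (fun t => g t * h t) = taylorSeries g * taylorSeries h := by
  ext n
  rw [PowerSeries.coeff_mul, Finset.Nat.sum_antidiagonal_eq_sum_range_succ_mk]
  simp only [taylorSeries, PowerSeries.coeff_mk]
  have := iteratedDeriv_mul (n := n) (x := (0 : ℝ)) hg.contDiffAt hh.contDiffAt
  rw [show (fun t => g t * h t) = g * h from rfl, this, Finset.mul_sum]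
  refine Finset.sum_congr rfl fun i hi => ?_
  have hi' : i ≤ n := by simpa [Nat.lt_succ_iff] using hi
  rw [Nat.cast_choose ℂ hi']
  have h1 : (n.factorial : ℂ) ≠ 0 := by exact_mod_cast n.factorial_ne_zero
  have h2 : (i.factorial : ℂ) ≠ 0 := by exact_mod_cast i.factorial_ne_zero
  have h3 : ((n - i).factorial : ℂ) ≠ 0 := by exact_mod_cast (n - i).factorial_ne_zero
  field_simp

theorem iteratedDeriv_cexp_mul_ofReal (x : ℂ) (n : ℕ) :
    iteratedDeriv n (fun t : ℝ => Complex.exp (x * (t : ℂ))) =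
      fun t : ℝ => x ^ n * Complex.exp (x * (t : ℂ)) := by
  induction n with
  | zero => simp
  | succ n ih =>
    rw [iteratedDeriv_succ, ih]
    funext t
    have h : HasDerivAt (fun t : ℝ => x * (t : ℂ)) x t := by
      simpa using (Complex.ofRealCLM.hasDerivAt (x := t)).const_mul x
    rw [(h.cexp.const_mul (x ^ n)).deriv]
    ring

theorem taylorSeries_cexp_mul (x : ℂ) :
    taylorSeries (fun t : ℝ => Complex.exp (x * (t : ℂ))) =
      PowerSeries.rescale x (PowerSeries.exp ℂ) := by
  ext n
  simp [taylorSeries, iteratedDeriv_cexp_mul_ofReal, PowerSeries.coeff_exp, mul_comm]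

theorem analyticAt_cexp_mul_ofReal (x : ℂ) :
    AnalyticAt ℝ (fun t : ℝ => Complex.exp (x * (t : ℂ))) 0 := by
  have h : AnalyticAt ℝ (fun t : ℝ => x * (t : ℂ)) 0 :=
    analyticAt_const.mul (Complex.ofRealCLM.analyticAt 0)
  exact (analyticAt_cexp.restrictScalars (𝕜 := ℝ)).fun_comp_of_eq h rfl

theorem taylorSeries_ofReal : taylorSeries (fun t : ℝ => (t : ℂ)) = PowerSeries.X := by
  have key : ∀ n, iteratedDeriv (n + 1) (fun t : ℝ => (t : ℂ)) 0 = if n = 0 then 1 else 0 := by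
    intro n
    have : deriv (fun t : ℝ => (t : ℂ)) = fun _ => 1 :=
      funext fun t => Complex.ofRealCLM.hasDerivAt.deriv
    rw [iteratedDeriv_succ', this, iteratedDeriv_const]
  ext n
  rcases n with _ | n
  · simp [taylorSeries]
  · rw [taylorSeries, PowerSeries.coeff_mk, key, PowerSeries.coeff_X]
    rcases n with _ | n <;> simp

theorem analyticAt_cexp_ofReal : AnalyticAt ℝ (fun t : ℝ => Complex.exp (t : ℂ)) 0 := by
  simpa using analyticAt_cexp_mul_ofReal 1

theorem taylorSeries_cexp_sub_one :
    taylorSeries (fun t : ℝ => Complex.exp (t : ℂ) - 1) = PowerSeries.exp ℂ - 1 := by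
  have h1 := taylorSeries_cexp_mul 1
  have h0 := taylorSeries_cexp_mul 0
  simp only [one_mul, zero_mul, Complex.exp_zero, PowerSeries.rescale_one, RingHom.id_apply] at h1 h0
  have : taylorSeries (fun t : ℝ => Complex.exp (t : ℂ) - 1) =
      taylorSeries (fun t : ℝ => Complex.exp (t : ℂ)) - taylorSeries (fun _ => 1) := by
    ext n
    simp only [taylorSeries, PowerSeries.coeff_mk, map_sub]
    rw [iteratedDeriv_fun_sub analyticAt_cexp_ofReal.contDiffAt contDiffAt_const, mul_sub]
  rw [this, h1, h0]
  simp [PowerSeries.rescale_zero]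

/-- The divided difference of exp absorbs the removable singularity at 0, so analyticity of `pFun f`
is inherited. -/
theorem pFun_eq_dslope (f : ℝ → ℂ) :
    pFun f = fun t => dslope (fun t : ℝ => Complex.exp (t : ℂ)) 0 t * f t := by
  funext t
  by_cases ht : t = 0
  · subst ht
    have h : HasDerivAt (fun t : ℝ => Complex.exp (t : ℂ)) 1 0 := by
      simpa using (Complex.ofRealCLM.hasDerivAt (x := (0 : ℝ))).cexp
    simp [pFun, h.deriv]
  · simp [pFun, ht, dslope_of_ne, slope_def_module, div_eq_inv_mul]

theorem analyticAt_pFun {f : ℝ → ℂ} (hf : AnalyticAt ℝ f 0) : AnalyticAt ℝ (pFun f) 0 := by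
  rw [pFun_eq_dslope]
  obtain ⟨p, hp⟩ := analyticAt_cexp_ofReal
  exact (hp.has_fpower_series_dslope_fslope.analyticAt).mul hf

theorem ofReal_mul_pFun (f : ℝ → ℂ) (t : ℝ) :
    (t : ℂ) * pFun f t = (Complex.exp (t : ℂ) - 1) * f t := by
  by_cases ht : t = 0
  · simp [ht]
  · have : (t : ℂ) ≠ 0 := by exact_mod_cast ht
    simp only [pFun, ht, if_false]
    field_simp

theorem pNum_eq (f : ℝ → ℂ) (n : ℕ) : pNum f n = iteratedDeriv n (pFun f) 0 := by
  simp [pNum, pPoly, cPoly]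

/-- The Bernoulli polynomial `B_n`, evaluated at a complex number. -/
noncomputable def bernoulliAt (n : ℕ) (x : ℂ) : ℂ := Polynomial.aeval x (Polynomial.bernoulli n)

theorem cPoly_eq_sum {f : ℝ → ℂ} (hf : AnalyticAt ℝ f 0) (n : ℕ) (x : ℂ) :
    cPoly f n x =
      ∑ k ∈ Finset.range (n + 1), (n.choose k : ℂ) * pNum f k * bernoulliAt (n - k) x := by
  have hp := analyticAt_pFun hf
  have he := analyticAt_cexp_mul_ofReal x
  have hT := taylorSeries_mul hf he
  set F := taylorSeries (fun t => f t * Complex.exp (x * (t : ℂ))) with hF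
  set B : PowerSeries ℂ := PowerSeries.mk fun n =>
    Polynomial.aeval x ((1 / n.factorial : ℚ) • Polynomial.bernoulli n) with hB
  have hBgen : B * (PowerSeries.exp ℂ - 1) =
      PowerSeries.X * PowerSeries.rescale x (PowerSeries.exp ℂ) :=
    Polynomial.bernoulli_generating_function x
  have e1 : AnalyticAt ℝ (fun t : ℝ => Complex.exp (t : ℂ) - 1) 0 :=
    analyticAt_cexp_ofReal.sub analyticAt_const
  have e0 : AnalyticAt ℝ (fun t : ℝ => (t : ℂ)) 0 := Complex.ofRealCLM.analyticAt 0
  have hXP : PowerSeries.X * taylorSeries (pFun f) =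
      (PowerSeries.exp ℂ - 1) * taylorSeries f := by
    rw [← taylorSeries_ofReal, ← taylorSeries_cexp_sub_one,
      ← taylorSeries_mul e0 hp, ← taylorSeries_mul e1 hf]
    congr 1
    exact funext (ofReal_mul_pFun f)
  have hne : (PowerSeries.exp ℂ - 1) ≠ 0 := by
    intro h
    have := congrArg (PowerSeries.coeff 1) h
    simp [PowerSeries.coeff_exp, PowerSeries.coeff_one] at this
  have hFB : F = taylorSeries (pFun f) * B := by
    -- e^t - 1 is not a unit, but power series over ℂ form a domain.
    apply mul_right_cancel₀ hne
    rw [hT, taylorSeries_cexp_mul]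
    linear_combination (-(PowerSeries.rescale x (PowerSeries.exp ℂ))) * hXP -
      taylorSeries (pFun f) * hBgen
  have hn := congrArg (PowerSeries.coeff n) hFB
  rw [PowerSeries.coeff_mul, Finset.Nat.sum_antidiagonal_eq_sum_range_succ_mk, hF] at hn
  simp only [taylorSeries, hB, PowerSeries.coeff_mk] at hn
  have h1 : (n.factorial : ℂ) ≠ 0 := by exact_mod_cast n.factorial_ne_zero
  rw [inv_mul_eq_iff_eq_mul₀ h1, Finset.mul_sum] at hn
  rw [cPoly, hn]
  refine Finset.sum_congr rfl fun i hi => ?_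
  have hi' : i ≤ n := by simpa [Nat.lt_succ_iff] using hi
  rw [Nat.cast_choose ℂ hi', pNum_eq, map_smul, bernoulliAt, Algebra.smul_def]
  have h2 : (i.factorial : ℂ) ≠ 0 := by exact_mod_cast i.factorial_ne_zero
  have h3 : ((n - i).factorial : ℂ) ≠ 0 := by exact_mod_cast (n - i).factorial_ne_zero
  simp only [eq_ratCast, Rat.cast_div, Rat.cast_one, Rat.cast_natCast]
  field_simp

theorem cPoly_under (f : ℝ → ℂ) (n : ℕ) (x : ℂ) :
    cPoly (under f) n (1 - x) = (-1) ^ n * cPoly f n x := by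
  have := iteratedDeriv_comp_neg n (fun t : ℝ => f t * Complex.exp (x * (t : ℂ))) 0
  simp only [neg_zero, Complex.real_smul] at this
  rw [cPoly, cPoly]
  push_cast at this
  rw [← this]
  congr 1
  funext t
  simp only [under]
  rw [mul_comm (Complex.exp _) (f _), mul_assoc, ← Complex.exp_add]
  congr 2
  ring

/-! ### Hurwitz zeta at positive integer parameter -/

/-- The entire function `w ↦ (w - 1) ζ(w)`. -/
noncomputable def regZeta : ℂ → ℂ := Function.update (fun w => (w - 1) * riemannZeta w) 1 1

theorem regZeta_of_ne {w : ℂ} (hw : w ≠ 1) : regZeta w = (w - 1) * riemannZeta w :=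
  Function.update_of_ne hw _ _

theorem differentiable_regZeta : Differentiable ℂ regZeta := by
  rw [← differentiableOn_univ,
    ← Complex.differentiableOn_compl_singleton_and_continuousAt_iff (c := 1) Filter.univ_mem]
  constructor
  · intro w hw
    have hw' : w ≠ 1 := hw.2
    have hd : DifferentiableAt ℂ (fun w => (w - 1) * riemannZeta w) w :=
      (differentiableAt_id.sub_const 1).mul (differentiableAt_riemannZeta hw')
    refine (hd.congr_of_eventuallyEq ?_).differentiableWithinAt
    filter_upwards [isOpen_ne.mem_nhds hw'] with v hv using regZeta_of_ne hv
  · exact continuousAt_update_same.mpr riemannZeta_residue_one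

/-- The entire function `w ↦ (w - 1) ζ(w, M + 1)`, with `ζ(w, x)` the Hurwitz zeta function. -/
noncomputable def regHurwitz (M : ℕ) (w : ℂ) : ℂ :=
  regZeta w - (w - 1) * ∑ n ∈ Finset.range M, ((n + 1 : ℕ) : ℂ) ^ (-w)

theorem differentiable_regHurwitz (M : ℕ) : Differentiable ℂ (regHurwitz M) := by
  refine differentiable_regZeta.sub ((differentiable_id.sub_const 1).mul ?_)
  refine Differentiable.fun_sum fun n _ w => ?_
  exact DifferentiableAt.const_cpow differentiable_neg.differentiableAt
    (Or.inl (by exact_mod_cast n.succ_ne_zero))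

theorem hasSum_regHurwitz (M : ℕ) {w : ℂ} (hw : 1 < w.re) :
    HasSum (fun j : ℕ => ((M + 1 + j : ℕ) : ℂ) ^ (-w)) (regHurwitz M w / (w - 1)) := by
  have hw1 : w ≠ 1 := by rintro rfl; simp at hw
  have hw1' : w - 1 ≠ 0 := sub_ne_zero.mpr hw1
  have hs : Summable fun n : ℕ => ((n + 1 : ℕ) : ℂ) ^ (-w) := by
    have := (summable_nat_add_iff 1).mpr (Complex.summable_one_div_nat_cpow.mpr hw)
    simpa [Complex.cpow_neg] using this
  have hz : HasSum (fun n : ℕ => ((n + 1 : ℕ) : ℂ) ^ (-w)) (riemannZeta w) := by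
    rw [zeta_eq_tsum_one_div_nat_add_one_cpow hw]
    convert! hs.hasSum using 3 with n
    simp [Complex.cpow_neg]
  have h := (hasSum_nat_add_iff' M).mpr hz
  convert! h using 1
  · funext j
    rw [add_comm (M + 1) j, add_assoc]
  · rw [regHurwitz, regZeta_of_ne hw1]
    field_simp

theorem bernoulliAt_ratCast (n : ℕ) (q : ℚ) :
    bernoulliAt n (q : ℂ) = (((Polynomial.bernoulli n).eval q : ℚ) : ℂ) := by
  have := Polynomial.aeval_algebraMap_apply_eq_algebraMap_eval (A := ℂ) q (Polynomial.bernoulli n)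
  simpa [bernoulliAt] using this

/-- Telescoping B(x+1) - B(x) from x = 1, where the value is `bernoulli'`, the convention of the
zeta values. -/
theorem bernoulliAt_natCast_add_one (i M : ℕ) :
    bernoulliAt (i + 1) (M + 1) =
      bernoulli' (i + 1) + (i + 1) * ∑ n ∈ Finset.range M, ((n : ℂ) + 1) ^ i := by
  have key : (Polynomial.bernoulli (i + 1)).eval ((M : ℚ) + 1) =
      bernoulli' (i + 1) + (i + 1) * ∑ n ∈ Finset.range M, ((n : ℚ) + 1) ^ i := by
    induction M with
    | zero => simp [Polynomial.bernoulli_eval_one]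
    | succ M ih =>
      push_cast
      rw [add_comm ((M : ℚ) + 1) 1, Polynomial.bernoulli_eval_one_add, ih, Finset.sum_range_succ]
      rw [Nat.add_sub_cancel]
      push_cast
      ring
  have h := bernoulliAt_ratCast (i + 1) ((M : ℚ) + 1)
  rw [key] at h
  push_cast at h
  exact h

/-- This is ζ(1-j, x) = -B_j(x)/j times w-1 = -j; at j = 0 it is the residue 1 = B_0. -/
theorem regHurwitz_one_sub_natCast (M j : ℕ) :
    regHurwitz M (1 - j) = bernoulliAt j (M + 1) := by
  rcases j with _ | i
  · simp [regHurwitz, regZeta, bernoulliAt]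
  · have h0 : (i : ℂ) + 1 ≠ 0 := by exact_mod_cast i.succ_ne_zero
    have hne : (1 - ((i + 1 : ℕ) : ℂ)) ≠ 1 := by
      push_cast
      intro h
      exact h0 (by linear_combination -h)
    rw [regHurwitz, regZeta_of_ne hne, bernoulliAt_natCast_add_one]
    have e : (1 - ((i + 1 : ℕ) : ℂ)) = -(i : ℂ) := by push_cast; ring
    rw [e, riemannZeta_neg_nat_eq_bernoulli', neg_neg]
    simp only [Complex.cpow_natCast]
    push_cast
    field_simp
    ring

/-! ### Binomial coefficients and growth bounds -/

/-- The rational function `binom(-z, k) / (z + k - 1)`, with its singularity removed for `k ≥ 1`. -/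
noncomputable def regChoose : ℕ → ℂ → ℂ
  | 0, z => 1 / (z - 1)
  | k + 1, z => (-1) ^ (k + 1) / ((k + 1).factorial : ℂ) * ∏ j ∈ Finset.range k, (z + j)

theorem choose_neg_eq_prod (z : ℂ) (k : ℕ) :
    Ring.choose (-z) k = (-1) ^ k / (k.factorial : ℂ) * ∏ j ∈ Finset.range k, (z + j) := by
  have key : (descPochhammer ℤ k).smeval (-z) = (-1) ^ k * ∏ j ∈ Finset.range k, (z + j) := by
    induction k with
    | zero => simp
    | succ k ih =>
      rw [descPochhammer_succ_right, Polynomial.smeval_mul, ih, Polynomial.smeval_sub,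
        Polynomial.smeval_X, Polynomial.smeval_natCast, Finset.prod_range_succ]
      simp
      ring
  rw [Ring.choose_eq_smul, key, smul_eq_mul]
  ring

theorem regChoose_mul (k : ℕ) {z : ℂ} (hz : z ≠ 1) :
    regChoose k z * (z + k - 1) = Ring.choose (-z) k := by
  have hz' : z - 1 ≠ 0 := sub_ne_zero.mpr hz
  rw [choose_neg_eq_prod]
  rcases k with _ | k
  · simp [regChoose, hz']
  · rw [regChoose, Finset.prod_range_succ]
    push_cast
    ring

theorem regChoose_neg_natCast (k m : ℕ) :
    regChoose k (-(m : ℂ)) = -(((m + 1).choose k : ℂ) / ((m : ℂ) + 1)) := by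
  have hm : (m : ℂ) + 1 ≠ 0 := by exact_mod_cast m.succ_ne_zero
  have hm' : -(m : ℂ) - 1 ≠ 0 := fun h => hm (by linear_combination -h)
  rcases k with _ | k
  · simp only [regChoose, Nat.choose_zero_right, Nat.cast_one]
    field_simp
    ring
  · have h := choose_neg_eq_prod (-(m : ℂ)) k
    rw [neg_neg, Ring.choose_natCast] at h
    have hk : (k.factorial : ℂ) ≠ 0 := by exact_mod_cast k.factorial_ne_zero
    have hk1 : (k : ℂ) + 1 ≠ 0 := by exact_mod_cast k.succ_ne_zero
    have hc : ((m : ℂ) + 1) * (m.choose k : ℂ) = ((m + 1).choose (k + 1) : ℂ) * ((k : ℂ) + 1) := by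
      exact_mod_cast Nat.add_one_mul_choose_eq m k
    rw [regChoose, Nat.factorial_succ]
    have hc' : ((m + 1).choose (k + 1) : ℂ) = ((m : ℂ) + 1) * (m.choose k : ℂ) / ((k : ℂ) + 1) := by
      rw [hc]; field_simp
    rw [hc', h]
    push_cast
    field_simp
    ring

theorem differentiableAt_regChoose (k : ℕ) {z : ℂ} (hz : z ≠ 1) :
    DifferentiableAt ℂ (regChoose k) z := by
  have hz' : z - 1 ≠ 0 := sub_ne_zero.mpr hz
  rcases k with _ | k
  · change DifferentiableAt ℂ (fun z : ℂ => 1 / (z - 1)) z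
    fun_prop (disch := assumption)
  · change DifferentiableAt ℂ (fun z : ℂ => (-1) ^ (k + 1) / ((k + 1).factorial : ℂ) *
      ∏ j ∈ Finset.range k, (z + j)) z
    fun_prop

/-- The coefficient of `x ^ k` in `(1 - x) ^ (-R)`. -/
noncomputable def risingCoeff (R : ℝ) (k : ℕ) : ℝ :=
  (∏ j ∈ Finset.range k, (R + j)) / k.factorial

theorem norm_choose_neg_le {R : ℝ} {z : ℂ} (hz : ‖z‖ ≤ R) (k : ℕ) :
    ‖Ring.choose (-z) k‖ ≤ risingCoeff R k := by
  rw [choose_neg_eq_prod, norm_mul, norm_div, norm_pow, norm_neg, norm_one, one_pow, norm_prod,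
    Complex.norm_natCast, risingCoeff, div_mul_eq_mul_div, one_mul]
  gcongr with j hj
  exact (norm_add_le _ _).trans (by rw [Complex.norm_natCast]; gcongr)

theorem risingCoeff_nonneg {R : ℝ} (hR : 0 ≤ R) (k : ℕ) : 0 ≤ risingCoeff R k := by
  unfold risingCoeff
  exact div_nonneg (Finset.prod_nonneg fun j _ => by positivity) (by positivity)

theorem summable_risingCoeff {R x : ℝ} (hR : 0 < R) (hx0 : 0 < x) (hx1 : x < 1) :
    Summable fun k => risingCoeff R k * x ^ k := by
  have hpos : ∀ k, 0 < risingCoeff R k := fun k => by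
    unfold risingCoeff
    exact div_pos (Finset.prod_pos fun j _ => by positivity) (by positivity)
  refine summable_of_ratio_test_tendsto_lt_one hx1
    (Eventually.of_forall fun k => (mul_pos (hpos k) (pow_pos hx0 k)).ne') ?_
  have hr : ∀ k : ℕ, ‖risingCoeff R (k + 1) * x ^ (k + 1)‖ / ‖risingCoeff R k * x ^ k‖ =
      (1 + (R - 1) * (1 / ((k : ℝ) + 1))) * x := by
    intro k
    have h1 := hpos k
    have h2 := pow_pos hx0 k
    rw [Real.norm_of_nonneg (mul_pos (hpos _) (pow_pos hx0 _)).le,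
      Real.norm_of_nonneg (mul_pos h1 h2).le, div_eq_iff (mul_pos h1 h2).ne']
    unfold risingCoeff
    rw [Finset.prod_range_succ, Nat.factorial_succ]
    push_cast
    have : (k.factorial : ℝ) ≠ 0 := by positivity
    field_simp
    ring
  simp_rw [hr]
  have := ((tendsto_one_div_add_atTop_nhds_zero_nat (𝕜 := ℝ)).const_mul (R - 1)).const_add 1
  simpa using this.mul_const x

theorem exists_norm_pNum_le {f : ℝ → ℂ} (hrho : rho f ≠ 0) :
    ∃ C a : ℝ, 0 < a ∧ a < nMin f ∧ ∀ k, ‖pNum f k‖ ≤ C * a ^ k := by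
  have hlt : (rho f)⁻¹ < (nMin f : ENNReal) := by
    have h1 : (rho f)⁻¹ ≠ ⊤ := ENNReal.inv_ne_top.mpr hrho
    rw [← ENNReal.ofReal_toReal h1, ← ENNReal.ofReal_natCast,
      ENNReal.ofReal_lt_ofReal_iff (by simp [nMin]; positivity)]
    simpa [nMin] using Nat.lt_floor_add_one ((rho f)⁻¹).toReal
  -- 1/N < r < ρ_f, possible since N > 1/ρ_f strictly; then a = 1/r.
  obtain ⟨r, hr1, hr2⟩ := ENNReal.lt_iff_exists_nnreal_btwn.mp (ENNReal.inv_lt_iff_inv_lt.mp hlt)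
  have hr0 : 0 < r := by
    have : (0 : ENNReal) < r := lt_of_le_of_lt zero_le hr1
    exact_mod_cast this
  obtain ⟨C, -, hC⟩ := FormalMultilinearSeries.norm_le_div_pow_of_pos_of_lt_radius _ hr0 hr2
  refine ⟨C, (r : ℝ)⁻¹, by positivity, ?_, fun k => ?_⟩
  · have h2 := ENNReal.inv_lt_iff_inv_lt.mp hr1
    rw [← ENNReal.coe_inv hr0.ne'] at h2
    have h3 : r⁻¹ < (nMin f : NNReal) := by exact_mod_cast h2
    exact_mod_cast h3
  · have := hC k
    rwa [FormalMultilinearSeries.ofScalars_norm, div_eq_mul_inv, ← inv_pow] at this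

/-! ### The continued series -/

/-- The terms of a series for `L(z, f)` that converges on all of `ℂ ∖ {1}`. -/
noncomputable def lcTerm (f : ℝ → ℂ) (k : ℕ) (z : ℂ) : ℂ :=
  pNum f k * regChoose k z * regHurwitz (nMin f - 1) (z + k)

/-- Only Re(z+k) > 1 is needed, so for large k this also bounds terms to the left of Re z = 1. -/
theorem hasSum_lcTerm (f : ℝ → ℂ) (k : ℕ) {z : ℂ} (hz : 1 < (z + k).re) (hz1 : z ≠ 1) :
    HasSum (fun j : ℕ => Ring.choose (-z) k * pNum f k * ((nMin f + j : ℕ) : ℂ) ^ (-z - k))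
      (lcTerm f k z) := by
  have hne : z + k - 1 ≠ 0 := by
    intro h
    rw [sub_eq_zero.mp h] at hz
    simp at hz
  have h := (hasSum_regHurwitz (nMin f - 1) hz).mul_left (Ring.choose (-z) k * pNum f k)
  have e : nMin f - 1 + 1 = nMin f := by simp [nMin]
  rw [e] at h
  convert! h using 1
  · funext j
    rw [neg_add, ← sub_eq_add_neg]
  · rw [lcTerm, ← regChoose_mul k hz1]
    field_simp

/-- Split the exponent: the power -y keeps summability in j, the rest is largest at j = 0 and gives
decay in k. -/
theorem norm_natCast_cpow_neg_le {N j k : ℕ} (hN : 0 < N) {z : ℂ} {x : ℝ} (hx : x ≤ z.re + k) {y : ℝ}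
    (hy : y ≤ x) :
    ‖((N + j : ℕ) : ℂ) ^ (-z - k)‖ ≤ ((N + j : ℕ) : ℝ) ^ (-y) * (N : ℝ) ^ (-(x - y)) := by
  have hN' : (1 : ℝ) ≤ N := by exact_mod_cast hN
  have hNj : (N : ℝ) ≤ ((N + j : ℕ) : ℝ) := by push_cast; linarith [(Nat.cast_nonneg j : (0 : ℝ) ≤ j)]
  have h0 : (0 : ℝ) < ((N + j : ℕ) : ℝ) := by linarith
  rw [Complex.norm_natCast_cpow_of_pos (by omega)]
  calc ((N + j : ℕ) : ℝ) ^ (-z - k).re ≤ ((N + j : ℕ) : ℝ) ^ (-y + -(x - y)) := by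
        apply Real.rpow_le_rpow_of_exponent_le (hN'.trans hNj)
        simp
        linarith
    _ = ((N + j : ℕ) : ℝ) ^ (-y) * ((N + j : ℕ) : ℝ) ^ (-(x - y)) := Real.rpow_add h0 _ _
    _ ≤ _ := by
        gcongr ?_ * ?_
        exact Real.rpow_le_rpow_of_nonpos (by linarith) hNj (by linarith)

theorem summable_natCast_add_rpow {N : ℕ} {y : ℝ} (hy : 1 < y) :
    Summable fun j : ℕ => ((N + j : ℕ) : ℝ) ^ (-y) := by
  have := (summable_nat_add_iff N).mpr (Real.summable_nat_rpow.mpr (neg_lt_neg hy))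
  simpa [add_comm] using this

theorem nMin_pos (f : ℝ → ℂ) : 0 < nMin f := Nat.succ_pos _

/-- Here k ≥ R+2 forces Re(z+k) ≥ 2, so the exponent is split at y = 2. -/
theorem exists_summable_norm_lcTerm_le {f : ℝ → ℂ} (hrho : rho f ≠ 0) {R : ℝ} (hR : 1 ≤ R) :
    ∃ u : ℕ → ℝ, Summable u ∧
      ∀ k : ℕ, R + 2 ≤ k → ∀ z : ℂ, ‖z‖ ≤ R → z ≠ 1 → ‖lcTerm f k z‖ ≤ u k := by
  obtain ⟨C, a, ha0, haN, hC⟩ := exists_norm_pNum_le hrho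
  have hC0 : 0 ≤ C := by simpa using (norm_nonneg _).trans (hC 0)
  set N := nMin f with hN
  have hN0 : (0 : ℝ) < N := by exact_mod_cast nMin_pos f
  have hsum : Summable fun j : ℕ => ((N + j : ℕ) : ℝ) ^ (-(2 : ℝ)) :=
    summable_natCast_add_rpow (by norm_num)
  set S : ℝ := ∑' j : ℕ, ((N + j : ℕ) : ℝ) ^ (-(2 : ℝ)) with hS
  refine ⟨fun k => C * S * (N : ℝ) ^ (R + 2) * (risingCoeff R k * (a / N) ^ k),
    (summable_risingCoeff (by linarith) (by positivity)
      ((div_lt_one hN0).mpr haN)).mul_left _, fun k hk z hz hz1 => ?_⟩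
  have hre : -R ≤ z.re := by
    have := (abs_le.mp (Complex.abs_re_le_norm z)).1
    linarith
  have hx : -R + k ≤ z.re + k := by linarith
  have h1 : 1 < (z + k).re := by
    simp
    linarith
  have hsumk := hasSum_lcTerm f k h1 hz1
  rw [← hsumk.tsum_eq]
  have hb := (hsum.hasSum.mul_right ((N : ℝ) ^ (-((-R + k) - 2)))).mul_left
    (risingCoeff R k * (C * a ^ k))
  refine (tsum_of_norm_bounded hb fun j => ?_).trans (le_of_eq ?_)
  · rw [norm_mul, norm_mul]
    have := risingCoeff_nonneg (show (0 : ℝ) ≤ R by linarith) k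
    exact mul_le_mul (mul_le_mul (norm_choose_neg_le hz k) (hC k) (norm_nonneg _) this)
      (norm_natCast_cpow_neg_le (nMin_pos f) hx (by linarith)) (norm_nonneg _) (by positivity)
  · dsimp only
    rw [show -((-R + k) - 2) = (R + 2) - (k : ℝ) by ring, Real.rpow_sub hN0, Real.rpow_natCast,
      div_pow]
    ring

theorem summable_lcTerm {f : ℝ → ℂ} (hrho : rho f ≠ 0) {z : ℂ} (hz : z ≠ 1) :
    Summable fun k => lcTerm f k z := by
  obtain ⟨u, hu, hb⟩ := exists_summable_norm_lcTerm_le hrho (show (1 : ℝ) ≤ ‖z‖ + 1 by simp)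
  refine Summable.of_norm_bounded_eventually_nat hu ?_
  filter_upwards [eventually_ge_atTop ⌈‖z‖ + 1 + 2⌉₊] with k hk
  exact hb k (Nat.ceil_le.mp hk) z (by linarith) hz

theorem differentiableAt_lcTerm (f : ℝ → ℂ) (k : ℕ) {z : ℂ} (hz : z ≠ 1) :
    DifferentiableAt ℂ (lcTerm f k) z :=
  ((differentiableAt_regChoose k hz).const_mul _).mul
    (((differentiable_regHurwitz _) _).comp z (differentiableAt_id.add_const _))

theorem differentiableOn_tsum_lcTerm {f : ℝ → ℂ} (hrho : rho f ≠ 0) :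
    DifferentiableOn ℂ (fun z => ∑' k, lcTerm f k z) {1}ᶜ := by
  intro z hz
  set R : ℝ := ‖z‖ + 1 with hR
  have hR1 : 1 ≤ R := by simp [hR]
  obtain ⟨u, hu, hb⟩ := exists_summable_norm_lcTerm_le hrho hR1
  set K := ⌈R + 2⌉₊ with hK
  set U : Set ℂ := Metric.ball 0 R ∩ {1}ᶜ with hU
  have hUo : IsOpen U := Metric.isOpen_ball.inter isOpen_compl_singleton
  have hzU : z ∈ U := ⟨by simp [hR], hz⟩
  -- The Weierstrass bound holds only from index K on; the head is a finite sum.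
  have htail : DifferentiableOn ℂ (fun z => ∑' k, lcTerm f (k + K) z) U := by
    refine Complex.differentiableOn_tsum_of_summable_norm ((summable_nat_add_iff K).mpr hu)
      (fun k w hw => (differentiableAt_lcTerm f _ hw.2).differentiableWithinAt) hUo
      fun k w hw => hb _ ?_ w ?_ hw.2
    · exact (Nat.le_ceil _).trans (by exact_mod_cast Nat.le_add_left K k)
    · simpa using (Metric.mem_ball.mp hw.1).le
  have hhead : DifferentiableOn ℂ (fun z => ∑ k ∈ Finset.range K, lcTerm f k z) U :=
    DifferentiableOn.fun_sum fun k _ w hw => (differentiableAt_lcTerm f k hw.2).differentiableWithinAt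
  have hd := ((hhead.add htail).differentiableAt (hUo.mem_nhds hzU))
  refine (hd.congr_of_eventuallyEq ?_).differentiableWithinAt
  filter_upwards [hUo.mem_nhds hzU] with w hw
  exact ((summable_lcTerm hrho hw.2).sum_add_tsum_nat_add K).symm

theorem hasSum_genPow {f : ℝ → ℂ} (hrho : rho f ≠ 0) {z : ℂ} (hz : 1 < z.re) :
    HasSum (fun j : ℕ => genPow f ((nMin f + j : ℕ) : ℂ) (-z)) (∑' k, lcTerm f k z) := by
  have hz1 : z ≠ 1 := by rintro rfl; simp at hz
  obtain ⟨C, a, ha0, haN, hC⟩ := exists_norm_pNum_le hrho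
  have hC0 : 0 ≤ C := by simpa using (norm_nonneg _).trans (hC 0)
  set N := nMin f with hN
  have hN0 : (0 : ℝ) < N := by exact_mod_cast nMin_pos f
  have hzn : 0 < ‖z‖ := norm_pos_iff.mpr (by rintro rfl; norm_num at hz)
  have hs1 : Summable fun k => C * (risingCoeff ‖z‖ k * (a / N) ^ k) :=
    (summable_risingCoeff hzn (by positivity) ((div_lt_one hN0).mpr haN)).mul_left _
  have hs2 : Summable fun j : ℕ => ((N + j : ℕ) : ℝ) ^ (-z.re) := summable_natCast_add_rpow hz
  set F : ℕ × ℕ → ℂ := fun p =>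
    Ring.choose (-z) p.2 * pNum f p.2 * ((N + p.1 : ℕ) : ℂ) ^ (-z - (p.2 : ℂ)) with hF
  -- Splitting the exponent at y = Re z dominates F by a product of a series in j and one in k.
  have hsF : Summable F := by
    refine Summable.of_norm_bounded (hs2.mul_of_nonneg hs1 (fun j => by positivity) fun k => ?_)
      fun ⟨j, k⟩ => ?_
    · have := risingCoeff_nonneg hzn.le k
      change 0 ≤ C * (risingCoeff ‖z‖ k * (a / N) ^ k)
      positivity
    · have h0 := risingCoeff_nonneg hzn.le k
      simp only [hF]
      rw [norm_mul, norm_mul]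
      refine (mul_le_mul (mul_le_mul (norm_choose_neg_le le_rfl k) (hC k) (norm_nonneg _) h0)
        (norm_natCast_cpow_neg_le (j := j) (nMin_pos f) (le_refl (z.re + k))
          (show z.re ≤ z.re + k by simp)) (norm_nonneg _) (by positivity)).trans (le_of_eq ?_)
      rw [show -(z.re + (k : ℝ) - z.re) = -(k : ℝ) by ring, Real.rpow_neg hN0.le, Real.rpow_natCast,
        div_pow]
      ring
  have hswap : ∑' p, F p = ∑' k, lcTerm f k z := by
    have h1 : ∑' p, F p = ∑' j, ∑' k, F (j, k) := hsF.tsum_prod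
    have h2 : ∑' k, ∑' j, F (j, k) = ∑' j, ∑' k, F (j, k) :=
      Summable.tsum_comm (f := fun j k => F (j, k)) hsF
    rw [h1, ← h2]
    refine tsum_congr fun k => (hasSum_lcTerm f k ?_ hz1).tsum_eq
    rw [Complex.add_re, Complex.natCast_re]
    linarith [(Nat.cast_nonneg k : (0 : ℝ) ≤ k)]
  rw [← hswap]
  exact hsF.hasSum.prod_fiberwise fun j => (hsF.prod_factor j).hasSum

theorem isLCFunction_tsum_lcTerm {f : ℝ → ℂ} (hrho : rho f ≠ 0) :
    IsLCFunction f fun z => ∑' k, lcTerm f k z :=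
  ⟨(differentiableOn_tsum_lcTerm hrho).analyticOnNhd isOpen_compl_singleton,
    fun _ hz => hasSum_genPow hrho hz⟩

/-! ### Uniqueness and special values -/

theorem IsLCFunction.eqOn {f : ℝ → ℂ} {L L' : ℂ → ℂ} (h : IsLCFunction f L)
    (h' : IsLCFunction f L') : Set.EqOn L L' {1}ᶜ := by
  refine h.1.eqOn_of_preconnected_of_eventuallyEq h'.1
    (isConnected_compl_singleton_of_one_lt_rank (by simp) 1).isPreconnected
    (show (2 : ℂ) ∈ ({1}ᶜ : Set ℂ) by simp) ?_
  have ho : IsOpen {z : ℂ | 1 < z.re} := isOpen_lt continuous_const Complex.continuous_re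
  filter_upwards [ho.mem_nhds (show (1 : ℝ) < (2 : ℂ).re by simp)] with z hz
  exact (h.2 z hz).unique (h'.2 z hz)

theorem tsum_lcTerm_neg_natCast {f : ℝ → ℂ} (hf : AnalyticAt ℝ f 0) (n : ℕ) :
    ∑' k, lcTerm f k (-(n : ℂ)) = -(cPoly f (n + 1) (nMin f : ℂ) / ((n : ℂ) + 1)) := by
  rw [tsum_eq_sum (s := Finset.range (n + 1 + 1)), cPoly_eq_sum hf, Finset.sum_div,
    ← Finset.sum_neg_distrib]
  · refine Finset.sum_congr rfl fun k hk => ?_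
    have hk' : k ≤ n + 1 := by simpa [Nat.lt_succ_iff] using hk
    have e : -(n : ℂ) + k = 1 - ((n + 1 - k : ℕ) : ℂ) := by
      rw [Nat.cast_sub hk']
      push_cast
      ring
    have e' : ((nMin f - 1 : ℕ) : ℂ) + 1 = nMin f := by simp [nMin]
    rw [lcTerm, regChoose_neg_natCast, e, regHurwitz_one_sub_natCast, e']
    ring
  · intro k hk
    have hk' : n + 1 < k := by simpa [Nat.lt_succ_iff] using hk
    simp [lcTerm, regChoose_neg_natCast, Nat.choose_eq_zero_of_lt hk']

end LC

theorem theorem5p5 (f : ℝ → ℂ) (hf : AnalyticAt ℝ f 0) (hrho : LC.rho f ≠ 0) :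
    (∃ L : ℂ → ℂ, LC.IsLCFunction f L) ∧
      ∀ L : ℂ → ℂ, LC.IsLCFunction f L → ∀ n : ℕ,
        L (-(n : ℂ)) = -(LC.cPoly f (n + 1) (LC.nMin f : ℂ) / ((n : ℂ) + 1)) ∧
        L (-(n : ℂ)) =
          (-1) ^ n * (LC.cPoly (LC.under f) (n + 1) (1 - (LC.nMin f : ℂ)) / ((n : ℂ) + 1)) := by
  refine ⟨⟨_, LC.isLCFunction_tsum_lcTerm hrho⟩, fun L hL n => ?_⟩
  have hn : -(n : ℂ) ∈ ({1}ᶜ : Set ℂ) := by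
    intro h
    have h1 := congrArg Complex.re (Set.mem_singleton_iff.mp h)
    simp only [Complex.neg_re, Complex.natCast_re, Complex.one_re] at h1
    linarith [(Nat.cast_nonneg n : (0 : ℝ) ≤ n)]
  have h := (hL.eqOn (LC.isLCFunction_tsum_lcTerm hrho) hn).trans
    (LC.tsum_lcTerm_neg_natCast hf n)
  refine ⟨h, ?_⟩
  rw [h, LC.cPoly_under, pow_succ]
  have : ((-1 : ℂ) ^ n) * (-1) ^ n = 1 := by rw [← mul_pow]; simp
  linear_combination (LC.cPoly f (n + 1) (LC.nMin f : ℂ) / ((n : ℂ) + 1)) * this
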